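/- Let $d\ge 1$, let $\|\cdot\|$ be any norm on $\mathbb{R}^d$, let $\mathcal{B}_r(x)=\{\tilde x:\|\tilde x-x\|\le r\}$ for $r\ge 0$, and let $\xi$ be a probability distribution on $\mathbb{R}^d$ that has a density with respect to Lebesgue measure. For a measurable binary classifier $f:\mathbb{R}^d\to\{0,1\}$ let $g_f(x)=\Pr_{\epsilon\sim\xi}[f(x+\epsilon)=1]$ be its smoothed version. For $\beta\in[0,1]$ define the worst-case directional derivative $$\Omega(\beta)=\sup_{\|\delta\|=1}\ \sup_{U\subseteq\mathbb{R}^d\text{ measurable},\ \xi(U)=\beta}\ \limsup_{s\to0^+}\frac{\xi(U-s\delta)-\beta}{s}\in[0,\infty]$$ (the upper limit is the limit whenever the limit exists), and $$F(\beta)=\int_\beta^{1/2}\frac{1}{\Omega(p)}\,dp\in[-\infty,\infty],$$ with $1/0=\infty$, $1/\infty=0$, and the usual orientation, $F(\beta)=-\int_{1/2}^{\beta}\frac{1}{\Omega(p)}\,dp$, for $\beta>1/2$. Call $c$ a certified upper (respectively lower) bound at level $\beta$ for $\mathcal{B}_r$ if, for every measurable binary classifier $f$ and every $x$ with $g_f(x)=\beta$,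 one has $g_f(\tilde x)\le c$ (respectively $g_f(\tilde x)\ge c$) for all $\tilde x\in\mathcal{B}_r(x)$. Let $\beta\in[0,1]$ and $r\ge0$. 1. If $r\le F(\beta)$, then $$\mathrm{c}^{\uparrow}[\beta,\mathcal{B}_r]=\sup\{\beta'\in[0,1]:F(\beta')\ge F(\beta)-r\}$$ is a certified upper bound at level $\beta$ for $\mathcal{B}_r$. 2. If $r\le F(1-\beta)$, then $$\mathrm{c}^{\downarrow}[\beta,\mathcal{B}_r]=\inf\{\beta'\in[0,1]:F(1-\beta')\ge F(1-\beta)-r\}$$ is a certified lower bound at level $\beta$ for $\mathcal{B}_r$. -/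

import Mathlib

open MeasureTheory Filter Topology Set
open scoped ENNReal

noncomputable section

namespace SmoothingCertificate

variable {E : Type*} [NormedAddCommGroup E] [NormedSpace ℝ E] [MeasurableSpace E]

/-- The smoothed classifier `g(x) = Pr_{ε ∼ ξ}[f(x + ε) = 1]` of a binary classifier `f`. -/
def smoothed (ξ : Measure E) (f : E → Bool) (x : E) : ℝ :=
  ξ.real {e | f (x + e) = true}

/-- The difference quotient `(ξ(U - rδ) - ξ(U)) / r`, where `U - rδ = {e | e + rδ ∈ U}`. -/
def shiftQuotient (ξ : Measure E) (U : Set E) (δ : E) (r : ℝ) : ℝ :=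
  (ξ.real {e | e + r • δ ∈ U} - ξ.real U) / r

/-- `Ω(β)`: the supremum, over unit vectors `δ` and measurable sets `U` with `ξ(U) = β`, of the
one-sided derivative `lim_{r → 0⁺} (ξ(U - rδ) - β) / r`. The derivative is taken as an upper limit
with extended real values, which is the limit whenever the limit exists. -/
def Omega (ξ : Measure E) (β : ℝ) : EReal :=
  ⨆ (δ : E) (_ : ‖δ‖ = 1) (U : Set E) (_ : MeasurableSet U) (_ : ξ.real U = β),
    limsup (fun r : ℝ => (shiftQuotient ξ U δ r : EReal)) (𝓝[>] 0)

/-- `1 / Ω(p)` in `[0, ∞]`, with `1 / 0 = ∞` and `1 / ∞ = 0`. -/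
def invOmega (ξ : Measure E) (p : ℝ) : ℝ≥0∞ :=
  ((Omega ξ p).toENNReal)⁻¹

/-- `F(β) = ∫_β^{1/2} 1/Ω(p) dp` as an extended real number: the oriented integral of a
non-negative function, hence minus the integral over `[1/2, β]` when `β > 1/2`. At most one of
the two terms is nonzero. -/
def F (ξ : Measure E) (β : ℝ) : EReal :=
  ((∫⁻ p in Ioc β (1 / 2), invOmega ξ p : ℝ≥0∞) : EReal) -
    ((∫⁻ p in Ioc (1 / 2) β, invOmega ξ p : ℝ≥0∞) : EReal)

/-- `c` is a certified upper bound at level `β` over the balls of radius `r`: whatever the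
(measurable) binary classifier, if its smoothed value at a point `x` is `β`, then its smoothed
value on the whole ball of radius `r` around `x` is at most `c`. -/
def IsUpperCertificate (ξ : Measure E) (β r c : ℝ) : Prop :=
  ∀ f : E → Bool, Measurable f → ∀ x : E, smoothed ξ f x = β →
    ∀ x' ∈ Metric.closedBall x r, smoothed ξ f x' ≤ c

/-- `c` is a certified lower bound at level `β` over the balls of radius `r`. -/
def IsLowerCertificate (ξ : Measure E) (β r c : ℝ) : Prop :=
  ∀ f : E → Bool, Measurable f → ∀ x : E, smoothed ξ f x = β →
    ∀ x' ∈ Metric.closedBall x r, c ≤ smoothed ξ f x'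

end SmoothingCertificate

end

/-!
Along a segment `t ↦ x + t • δ` with `‖δ‖ = 1`, the smoothed classifier is a function `h` of `t`
that is continuous, because translation acts continuously on the density of `ξ` in `L¹`
(`continuous_measureReal_translate`), and whose upper right derivative at `t` is at most `Ω (h t)`
by the very definition of `Ω`.

The heart of the proof is that such an `h` needs time at least `∫ 1 / Ω` over `(h 0, h T]` to climb
from `h 0` to `h T` (`lintegral_inv_le_of_limsup_slope_le`). Nothing is known about the regularity
of `Ω`, and `h` need not be differentiable, so one argues with the first hitting time
`τ p = inf {t | p ≤ h t}` instead. It is monotone with `h (τ p) = p`, hence differentiable almost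
everywhere; where it is, the difference quotients of `h` at `τ p` along the points `τ q`, `q ↓ p`,
tend to `1 / τ' p`, so that `1 / Ω p ≤ τ' p`. By Lebesgue's theorem on monotone functions, `∫ τ'`
is at most the increment of `τ`, which is at most `T`.

Hence `F (g x) - r ≤ F (g x')` whenever `‖x' - x‖ ≤ r` (`F_smoothed_sub_le`), which says that
`g x'` belongs to the set whose supremum is the upper certificate. The lower certificate follows
by passing to the complementary classifier `1 - f`.
-/

open MeasureTheory Filter Topology Set
open scoped ENNReal

namespace SmoothingCertificate

/-! ### Hitting times of functions with a bound on the upper derivative -/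

section HittingTime

/-- The first time in `[0, T]` at which `h` reaches the level `p`. -/
noncomputable def hittingTime (h : ℝ → ℝ) (T p : ℝ) : ℝ :=
  sInf {t | t ∈ Icc 0 T ∧ p ≤ h t}

variable {h : ℝ → ℝ} {T p : ℝ}

theorem hittingTime_mem (hh : Continuous h) (hT : 0 ≤ T) (hp : p ≤ h T) :
    hittingTime h T p ∈ Icc 0 T ∧ p ≤ h (hittingTime h T p) := by
  have hcl : IsClosed {t | t ∈ Icc 0 T ∧ p ≤ h t} :=
    isClosed_Icc.inter (isClosed_le continuous_const hh)
  exact hcl.csInf_mem ⟨T, ⟨hT, le_rfl⟩, hp⟩ ⟨0, fun t ht => ht.1.1⟩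

theorem hittingTime_le {t : ℝ} (ht : t ∈ Icc 0 T) (hp : p ≤ h t) : hittingTime h T p ≤ t :=
  csInf_le ⟨0, fun _ hs => hs.1.1⟩ ⟨ht, hp⟩

theorem apply_hittingTime (hh : Continuous h) (hT : 0 ≤ T) (hp : p ∈ Icc (h 0) (h T)) :
    h (hittingTime h T p) = p := by
  obtain ⟨hτ, hpτ⟩ := hittingTime_mem hh hT hp.2
  obtain ⟨t, ht, rfl⟩ := intermediate_value_Icc hτ.1 hh.continuousOn ⟨hp.1, hpτ⟩
  rw [le_antisymm (hittingTime_le ⟨ht.1, ht.2.trans hτ.2⟩ le_rfl) ht.2]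

theorem monotoneOn_hittingTime (hh : Continuous h) (hT : 0 ≤ T) :
    MonotoneOn (hittingTime h T) (Iic (h T)) := by
  intro p _ q hq hpq
  obtain ⟨hτ, hqτ⟩ := hittingTime_mem hh hT hq
  exact hittingTime_le hτ (hpq.trans hqτ)

/-- Where the hitting time is differentiable, its derivative dominates the reciprocal of any bound
on the upper right derivative of the function. -/
theorem inv_toENNReal_le_deriv_hittingTime (hh : Continuous h) (hT : 0 ≤ T)
    (hp : p ∈ Ioo (h 0) (h T)) (hd : DifferentiableAt ℝ (hittingTime h T) p) {w : EReal}
    (hw : limsup (fun s : ℝ => (((h (hittingTime h T p + s) - h (hittingTime h T p)) / s : ℝ) :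
      EReal)) (𝓝[>] 0) ≤ w) :
    (w.toENNReal)⁻¹ ≤ ENNReal.ofReal (deriv (hittingTime h T) p) := by
  set τ := hittingTime h T with hτ
  have hτp : h (τ p) = p := apply_hittingTime hh hT (Ioo_subset_Icc_self hp)
  have hev : ∀ᶠ q in 𝓝[>] p, p < q ∧ h (τ q) = q ∧ τ p < τ q := by
    filter_upwards [Ioo_mem_nhdsGT hp.2] with q hq
    have hτq : h (τ q) = q := apply_hittingTime hh hT ⟨(hp.1.trans hq.1).le, hq.2.le⟩
    refine ⟨hq.1, hτq, (monotoneOn_hittingTime hh hT hp.2.le hq.2.le hq.1.le).lt_of_ne ?_⟩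
    intro he
    exact hq.1.ne (by rw [← hτp, ← hτq]; exact congrArg h he)
  have hlim : Tendsto (fun q => τ q - τ p) (𝓝[>] p) (𝓝[>] 0) := by
    refine tendsto_nhdsWithin_iff.2 ⟨?_, hev.mono fun q hq => sub_pos.2 hq.2.2⟩
    have := (hd.continuousAt.tendsto.mono_left (nhdsWithin_le_nhds (s := Ioi p))).sub_const (τ p)
    rwa [sub_self] at this
  rw [ENNReal.inv_le_iff_inv_le]
  refine le_of_forall_gt_imp_ge_of_dense fun y hy => ?_
  rcases eq_or_ne y ⊤ with rfl | hy'
  · exact le_top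
  lift y to NNReal using hy'
  have hwy : w < ((y : ℝ) : EReal) := by
    by_contra! hle
    have := EReal.toENNReal_le_toENNReal hle
    rw [EReal.toENNReal_of_ne_top (EReal.coe_ne_top _), EReal.toReal_coe,
      ENNReal.ofReal_coe_nnreal] at this
    exact absurd hy this.not_gt
  have hy0 : 0 < y := ENNReal.coe_pos.1 (pos_of_gt hy)
  -- Eventually `(q - p) / (τ q - τ p) < y`, so the slope of `τ` between `p` and `q` exceeds `y⁻¹`.
  have hy1 : (y : ℝ)⁻¹ ≤ deriv τ p := by
    have hslope := (hasDerivAt_iff_tendsto_slope.1 hd.hasDerivAt).mono_left (nhdsGT_le_nhdsNE p)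
    refine ge_of_tendsto hslope ?_
    filter_upwards [hlim.eventually (eventually_lt_of_limsup_lt (hw.trans_lt hwy)), hev]
      with q hq ⟨hpq, hτq, hτpq⟩
    rw [EReal.coe_lt_coe_iff, add_sub_cancel, hτq, hτp, div_lt_iff₀ (sub_pos.2 hτpq)] at hq
    rw [slope_def_field, inv_le_iff_one_le_mul₀ (NNReal.coe_pos.2 hy0), div_mul_eq_mul_div,
      one_le_div (sub_pos.2 hpq), mul_comm]
    exact hq.le
  rw [← ENNReal.inv_le_iff_inv_le, ← ENNReal.coe_inv hy0.ne', ← ENNReal.ofReal_coe_nnreal,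
    NNReal.coe_inv]
  exact ENNReal.ofReal_le_ofReal hy1

/-- A continuous function whose upper right derivative at `t` is at most `w (h t)` needs time at
least `∫ 1 / w` to climb from `h 0` to `h T`. No measurability of `w` is needed. -/
theorem lintegral_inv_le_of_limsup_slope_le (hh : Continuous h) (hT : 0 ≤ T) {w : ℝ → EReal}
    (hw : ∀ t, limsup (fun s : ℝ => (((h (t + s) - h t) / s : ℝ) : EReal)) (𝓝[>] 0) ≤ w (h t)) :
    ∫⁻ p in Ioc (h 0) (h T), ((w p).toENNReal)⁻¹ ≤ ENNReal.ofReal T := by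
  rcases le_total (h T) (h 0) with hle | hle
  · simp [Ioc_eq_empty_of_le hle]
  set τ := hittingTime h T with hτ
  have hmono : MonotoneOn τ (Icc (h 0) (h T)) :=
    (monotoneOn_hittingTime hh hT).mono fun p hp => hp.2
  have hint : IntegrableOn (deriv τ) (Ioo (h 0) (h T)) := by
    have : IntervalIntegrable (deriv τ) volume (h 0) (h T) :=
      MonotoneOn.intervalIntegrable_deriv (by rwa [uIcc_of_le hle])
    exact (intervalIntegrable_iff_integrableOn_Ioo_of_le hle).1 this
  have hbound : ∫ p in Ioo (h 0) (h T), deriv τ p ≤ τ (h T) - τ (h 0) := by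
    have h1 := MonotoneOn.intervalIntegral_deriv_mem_uIcc (f := τ) (a := h 0) (b := h T)
      (by rwa [uIcc_of_le hle])
    have h2 : 0 ≤ τ (h T) - τ (h 0) :=
      sub_nonneg.2 (hmono (left_mem_Icc.2 hle) (right_mem_Icc.2 hle) hle)
    rw [uIcc_of_le h2, intervalIntegral.integral_of_le hle, integral_Ioc_eq_integral_Ioo] at h1
    exact h1.2
  have hnonneg : 0 ≤ᵐ[volume.restrict (Ioo (h 0) (h T))] deriv τ := by
    filter_upwards [ae_restrict_mem measurableSet_Ioo] with p hp
    rw [Pi.zero_apply, ← derivWithin_of_mem_nhds (Icc_mem_nhds hp.1 hp.2)]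
    exact hmono.derivWithin_nonneg
  calc ∫⁻ p in Ioc (h 0) (h T), ((w p).toENNReal)⁻¹
      = ∫⁻ p in Ioo (h 0) (h T), ((w p).toENNReal)⁻¹ := by
        rw [Measure.restrict_congr_set Ioo_ae_eq_Ioc]
    _ ≤ ∫⁻ p in Ioo (h 0) (h T), ENNReal.ofReal (deriv τ p) := by
        refine lintegral_mono_ae ?_
        refine (ae_restrict_iff' measurableSet_Ioo).2 ?_
        filter_upwards [hmono.ae_differentiableWithinAt_of_mem] with p hpd hp
        have hd := (hpd (Ioo_subset_Icc_self hp)).differentiableAt (Icc_mem_nhds hp.1 hp.2)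
        refine inv_toENNReal_le_deriv_hittingTime hh hT hp hd ((hw _).trans_eq ?_)
        rw [apply_hittingTime hh hT (Ioo_subset_Icc_self hp)]
    _ = ENNReal.ofReal (∫ p in Ioo (h 0) (h T), deriv τ p) :=
        (ofReal_integral_eq_lintegral_ofReal hint hnonneg).symm
    _ ≤ ENNReal.ofReal T := by
        refine ENNReal.ofReal_le_ofReal (hbound.trans ?_)
        have h1 := (hittingTime_mem hh hT (le_refl (h T))).1.2
        have h2 := (hittingTime_mem hh hT hle).1.1
        linarith

end HittingTime

/-! ### The smoothed classifier along segments -/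

variable {E : Type*} [NormedAddCommGroup E] [NormedSpace ℝ E] [MeasurableSpace E]

section Translation

variable [FiniteDimensional ℝ E] [BorelSpace E] {ξ : Measure E} [IsProbabilityMeasure ξ]

/-- The map is `c ↦ ∫ e in V, ρ (e - c)` for the density `ρ` of `ξ`, and translation acts
continuously on `L¹`. -/
theorem continuous_measureReal_translate
    {μ : Measure E} [μ.IsAddHaarMeasure] (hξ : ξ ≪ μ) {V : Set E} (hV : MeasurableSet V) :
    Continuous fun c : E => ξ.real {e | c + e ∈ V} := by
  have : Fact ((1 : ℝ≥0∞) ≠ ⊤) := ⟨ENNReal.one_ne_top⟩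
  let ρ : E → ℝ := fun e => (ξ.rnDeriv μ e).toReal
  have hρ : MemLp ρ 1 μ := memLp_one_iff_integrable.2 Measure.integrable_toReal_rnDeriv
  have hcont : Continuous fun c : E => ∫ e in V, (DomAddAct.mk (-c) +ᵥ hρ.toLp ρ) e ∂μ :=
    (continuous_setIntegral V).comp
      ((DomAddAct.continuous_mk.comp continuous_neg).vadd continuous_const)
  refine hcont.congr fun c => ?_
  have hpre : {e | c + e ∈ V} = (fun e => c + e) ⁻¹' V := rfl
  rw [← Measure.setIntegral_toReal_rnDeriv hξ, hpre,
    ← (measurePreserving_add_left μ c).setIntegral_preimage_emb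
      (measurableEmbedding_addLeft c)]
  refine setIntegral_congr_ae (measurable_const_add c hV) ?_
  have h1 : ∀ᵐ y ∂μ, (DomAddAct.mk (-c) +ᵥ hρ.toLp ρ) y = ρ (-c + y) := by
    rw [DomAddAct.mk_vadd_toLp]
    exact MemLp.coeFn_toLp _
  filter_upwards [(measurePreserving_add_left μ c).quasiMeasurePreserving.ae h1] with e he _
  rw [he, neg_add_cancel_left]

variable {f : E → Bool}

omit [NormedSpace ℝ E] [FiniteDimensional ℝ E] in
theorem measurableSet_add_mem_true (hf : Measurable f) (x : E) :
    MeasurableSet {e | f (x + e) = true} :=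
  measurable_const_add x (hf (measurableSet_singleton true))

theorem continuous_smoothed (hξ : ξ ≪ (Measure.addHaar : Measure E)) (hf : Measurable f) :
    Continuous (smoothed ξ f) :=
  continuous_measureReal_translate hξ (hf (measurableSet_singleton true))

omit [FiniteDimensional ℝ E] [IsProbabilityMeasure ξ] in
/-- The set `U = {e | f (y + e) = 1}` is admissible in the supremum defining `Ω`. -/
theorem limsup_slope_smoothed_le_Omega (hf : Measurable f) (y : E) {δ : E} (hδ : ‖δ‖ = 1) :
    limsup (fun s : ℝ => (((smoothed ξ f (y + s • δ) - smoothed ξ f y) / s : ℝ) : EReal)) (𝓝[>] 0)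
      ≤ Omega ξ (smoothed ξ f y) := by
  refine le_trans (le_of_eq ?_) (le_iSup₂_of_le δ hδ <| le_iSup₂_of_le {e | f (y + e) = true}
    (measurableSet_add_mem_true hf y) <| le_iSup_of_le rfl le_rfl)
  congr 1
  funext s
  simp only [shiftQuotient, smoothed, mem_ofPred_eq, add_assoc, add_comm (s • δ)]

/-- Climbing from `g x` to `g x'` costs a distance of at least the integral of `1 / Ω`. -/
theorem lintegral_invOmega_le (hξ : ξ ≪ (Measure.addHaar : Measure E)) (hf : Measurable f)
    (x x' : E) :
    ∫⁻ p in Ioc (smoothed ξ f x) (smoothed ξ f x'), invOmega ξ p ≤ ENNReal.ofReal ‖x' - x‖ := by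
  rcases eq_or_ne x' x with rfl | hne
  · simp
  have hn : ‖x' - x‖ ≠ 0 := norm_ne_zero_iff.2 (sub_ne_zero.2 hne)
  let δ : E := ‖x' - x‖⁻¹ • (x' - x)
  have hδ : ‖δ‖ = 1 := by
    rw [norm_smul, norm_inv, norm_norm, inv_mul_cancel₀ hn]
  let h : ℝ → ℝ := fun t => smoothed ξ f (x + t • δ)
  have hh : Continuous h := (continuous_smoothed hξ hf).comp (by fun_prop)
  have h0 : h 0 = smoothed ξ f x := by simp [h]
  have h1 : h ‖x' - x‖ = smoothed ξ f x' := by simp [h, δ, smul_inv_smul₀ hn]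
  rw [← h0, ← h1]
  refine lintegral_inv_le_of_limsup_slope_le hh (norm_nonneg _) (w := Omega ξ) fun t => ?_
  simpa only [h, add_smul, add_assoc] using
    limsup_slope_smoothed_le_Omega (ξ := ξ) hf (x + t • δ) hδ

omit [NormedSpace ℝ E] [FiniteDimensional ℝ E] in
theorem smoothed_not (hf : Measurable f) (x : E) :
    smoothed ξ (fun y => !f y) x = 1 - smoothed ξ f x := by
  rw [smoothed, smoothed, ← probReal_compl_eq_one_sub (measurableSet_add_mem_true hf x)]
  congr 1
  ext e
  simp

end Translation

/-! ### The potential `F` -/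

theorem F_antitone (ξ : Measure E) : Antitone (F ξ) := fun _ _ hab =>
  EReal.sub_le_sub (EReal.coe_ennreal_le_coe_ennreal_iff.2
      (lintegral_mono_set (Ioc_subset_Ioc_left hab)))
    (EReal.coe_ennreal_le_coe_ennreal_iff.2 (lintegral_mono_set (Ioc_subset_Ioc_right hab)))

theorem F_of_le {ξ : Measure E} {β : ℝ} (h : β ≤ 1 / 2) :
    F ξ β = ((∫⁻ p in Ioc β (1 / 2), invOmega ξ p : ℝ≥0∞) : EReal) := by
  rw [F, Ioc_eq_empty_of_le h]
  simp

theorem F_of_ge {ξ : Measure E} {β : ℝ} (h : 1 / 2 ≤ β) :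
    F ξ β = -((∫⁻ p in Ioc (1 / 2) β, invOmega ξ p : ℝ≥0∞) : EReal) := by
  rw [F, Ioc_eq_empty_of_le h]
  simp

theorem lintegral_Ioc_add (g : ℝ → ℝ≥0∞) {a b c : ℝ} (hab : a ≤ b) (hbc : b ≤ c) :
    ∫⁻ p in Ioc a c, g p = (∫⁻ p in Ioc a b, g p) + ∫⁻ p in Ioc b c, g p := by
  rw [← Ioc_union_Ioc_eq_Ioc hab hbc, lintegral_union measurableSet_Ioc]
  exact Set.disjoint_left.2 fun p hp hp' => hp'.1.not_ge hp.2

/-- The split according to the position of `1 / 2` avoids the junk value of `∞ - ∞`: each of `F a`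
and `F b` is then one integral up to sign. -/
theorem F_sub_le_of_lintegral_le {ξ : Measure E} {a b r : ℝ} (hr : 0 ≤ r) (hab : a ≤ b)
    (h : ∫⁻ p in Ioc a b, invOmega ξ p ≤ ENNReal.ofReal r) : F ξ a - (r : EReal) ≤ F ξ b := by
  have hr' : ((ENNReal.ofReal r : ℝ≥0∞) : EReal) = r := by
    rw [EReal.coe_ennreal_ofReal, max_eq_left hr]
  have h' := EReal.coe_ennreal_le_coe_ennreal_iff.2 h
  rw [hr'] at h'
  rcases le_total b (1 / 2) with hb | hb
  · rw [F_of_le (hab.trans hb), F_of_le hb, lintegral_Ioc_add _ hab hb, EReal.coe_ennreal_add]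
    refine EReal.sub_le_of_le_add ?_
    rw [add_comm]
    gcongr
  · rcases le_total a (1 / 2) with ha | ha
    · rw [lintegral_Ioc_add _ ha hb] at h
      rw [F_of_le ha, F_of_ge hb]
      have h1 : ∫⁻ p in Ioc (1 / 2) b, invOmega ξ p ≠ ⊤ :=
        ((le_add_self.trans h).trans_lt ENNReal.ofReal_lt_top).ne
      have h2 : ∫⁻ p in Ioc a (1 / 2), invOmega ξ p ≠ ⊤ :=
        ((le_self_add.trans h).trans_lt ENNReal.ofReal_lt_top).ne
      lift (∫⁻ p in Ioc (1 / 2) b, invOmega ξ p) to NNReal using h1 with u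
      lift (∫⁻ p in Ioc a (1 / 2), invOmega ξ p) to NNReal using h2 with v
      have h3 : (v : ℝ) + u ≤ r := by
        rwa [← ENNReal.coe_add, ENNReal.le_ofReal_iff_toReal_le ENNReal.coe_ne_top hr,
          ENNReal.coe_toReal, NNReal.coe_add] at h
      change (((v : ℝ) : EReal)) - r ≤ -((u : ℝ) : EReal)
      rw [← EReal.coe_neg, ← EReal.coe_sub, EReal.coe_le_coe_iff]
      linarith
    · rw [F_of_ge ha, F_of_ge hb, lintegral_Ioc_add _ ha hab, EReal.coe_ennreal_add,
        EReal.neg_add (by simp) (by simp)]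
      exact EReal.sub_le_sub le_rfl h'

/-- Moving by at most `r` lowers the potential `F` of the smoothed value by at most `r`. This holds
also for infinite values of `F`, where `∞ - r = ∞`. -/
theorem F_smoothed_sub_le [FiniteDimensional ℝ E] [BorelSpace E] {ξ : Measure E}
    [IsProbabilityMeasure ξ] (hξ : ξ ≪ (Measure.addHaar : Measure E)) {f : E → Bool}
    (hf : Measurable f) {x x' : E} {r : ℝ} (hx' : x' ∈ Metric.closedBall x r) :
    F ξ (smoothed ξ f x) - (r : EReal) ≤ F ξ (smoothed ξ f x') := by
  have hxr : ‖x' - x‖ ≤ r := mem_closedBall_iff_norm.1 hx'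
  have hr : 0 ≤ r := (norm_nonneg _).trans hxr
  rcases le_total (smoothed ξ f x) (smoothed ξ f x') with hle | hle
  · exact F_sub_le_of_lintegral_le hr hle
      ((lintegral_invOmega_le hξ hf x x').trans (ENNReal.ofReal_le_ofReal hxr))
  · exact ((EReal.sub_le_sub le_rfl (EReal.coe_nonneg.2 hr)).trans_eq (sub_zero _)).trans (F_antitone ξ hle)

omit [NormedSpace ℝ E] in
theorem smoothed_mem_Icc (ξ : Measure E) [IsProbabilityMeasure ξ] (f : E → Bool) (x : E) :
    smoothed ξ f x ∈ Icc (0 : ℝ) 1 :=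
  ⟨measureReal_nonneg, measureReal_le_one⟩

end SmoothingCertificate

theorem mainTheorem3 {E : Type*} [NormedAddCommGroup E] [NormedSpace ℝ E]
    [FiniteDimensional ℝ E] [MeasurableSpace E] [BorelSpace E]
    (ξ : MeasureTheory.Measure E) [MeasureTheory.IsProbabilityMeasure ξ]
    (hξ : ξ.AbsolutelyContinuous (MeasureTheory.Measure.addHaar : MeasureTheory.Measure E))
    (β r : ℝ) (hβ : β ∈ Set.Icc (0 : ℝ) 1) (hr : 0 ≤ r) :
    ((r : EReal) ≤ SmoothingCertificate.F ξ β →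
      SmoothingCertificate.IsUpperCertificate ξ β r
        (sSup {β' : ℝ | β' ∈ Set.Icc (0 : ℝ) 1 ∧
          SmoothingCertificate.F ξ β - (r : EReal) ≤ SmoothingCertificate.F ξ β'})) ∧
    ((r : EReal) ≤ SmoothingCertificate.F ξ (1 - β) →
      SmoothingCertificate.IsLowerCertificate ξ β r
        (sInf {β' : ℝ | β' ∈ Set.Icc (0 : ℝ) 1 ∧
          SmoothingCertificate.F ξ (1 - β) - (r : EReal) ≤
            SmoothingCertificate.F ξ (1 - β')})) := by
  refine ⟨fun _ f hf x hx x' hx' => ?_, fun _ f hf x hx x' hx' => ?_⟩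
  · refine le_csSup ⟨1, fun _ hb => hb.1.2⟩
      ⟨SmoothingCertificate.smoothed_mem_Icc ξ f x', ?_⟩
    rw [← hx]
    exact SmoothingCertificate.F_smoothed_sub_le hξ hf hx'
  · have hnot : Measurable fun y => !f y := (measurable_of_countable not).comp hf
    refine csInf_le ⟨0, fun _ hb => hb.1.1⟩
      ⟨SmoothingCertificate.smoothed_mem_Icc ξ f x', ?_⟩
    rw [← hx, ← SmoothingCertificate.smoothed_not hf, ← SmoothingCertificate.smoothed_not hf]
    exact SmoothingCertificate.F_smoothed_sub_le hξ hnot hx'
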